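/- All graphs are finite and simple. A linear order on the vertex set $V(G)$ of a graph $G$ is represented by an injective function $L\colon V(G)\to\mathbb{N}$; let $\Pi(G)$ be the set of these. For $r\in\mathbb{N}$, a vertex $u$ is weakly $r$-reachable from $v$ with respect to $L$ if there is a path $P$ of length $\ell$, $0\le \ell\le r$, from $v$ to $u$ such that $L(u)\le L(w)$ for all $w\in V(P)$; if moreover $P$ can be chosen so that all its inner vertices $w$ satisfy $L(v)<L(w)$, then $u$ is strongly $r$-reachable from $v$. Let $\mathrm{WReach}_r[G,L,v]$ and $\mathrm{SReach}_r[G,L,v]$ be the sets of vertices that are weakly, respectively strongly, $r$-reachable from $v$ with respect to $L$, and let $$\mathrm{wcol}_r(G)=\min_{L\in\Pi(G)}\max_{v\in V(G)}|\mathrm{WReach}_r[G,L,v]|,\qquad \mathrm{col}_r(G)=\min_{L\in\Pi(G)}\max_{v\in V(G)}|\mathrm{SReach}_r[G,L,v]|.$$ Corollary. For all integers $k\ge 1$ and $r\ge 1$ there is a graph $G^k_r$ such that for all integers $r'$ with $1\le r'\le r$ we have $$\mathrm{col}_{r'}(G^k_r)=k+1\qquad\text{and}\qquad \mathrm{wcol}_{r'}(G^k_r)\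 \ge\ \left(\frac{\mathrm{col}_{r'}(G^k_r)}{r'}\right)^{r'}.$$ -/

import Mathlib

namespace GeneralisedColouring

variable {V : Type*}

/-- The set of vertices `u` that are weakly `r`-reachable from `v` with respect to the order
represented by `L`: some path of length at most `r` from `v` to `u` has `u` as its `L`-minimum. -/
def WReach (G : SimpleGraph V) (L : V → ℕ) (r : ℕ) (v : V) : Set V :=
  {u | ∃ p : G.Walk v u, p.IsPath ∧ p.length ≤ r ∧ ∀ w ∈ p.support, L u ≤ L w}

/-- The set of vertices `u` that are strongly `r`-reachable from `v` with respect to `L`: as for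
weak reachability, and every inner vertex of the path is larger than `v`. -/
def SReach (G : SimpleGraph V) (L : V → ℕ) (r : ℕ) (v : V) : Set V :=
  {u | ∃ p : G.Walk v u, p.IsPath ∧ p.length ≤ r ∧ (∀ w ∈ p.support, L u ≤ L w) ∧
    ∀ w ∈ p.support, w ≠ v → w ≠ u → L v < L w}

/-- The weak `r`-colouring number of a finite graph: the minimum, over all linear orders of the
vertices (represented as injections into `ℕ`), of the maximal size of a weak `r`-reach. -/
noncomputable def wcol [Fintype V] (G : SimpleGraph V) (r : ℕ) : ℕ :=
  ⨅ L : V ↪ ℕ, Finset.univ.sup fun v => (WReach G L r v).ncard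

/-- The `r`-colouring number of a finite graph: the minimum, over all linear orders of the
vertices, of the maximal size of a strong `r`-reach. -/
noncomputable def col [Fintype V] (G : SimpleGraph V) (r : ℕ) : ℕ :=
  ⨅ L : V ↪ ℕ, Finset.univ.sup fun v => (SReach G L r v).ncard

/-- The minimum in the definition of `wcol` is attained. -/
theorem exists_wcol_eq [Fintype V] (G : SimpleGraph V) (r : ℕ) :
    ∃ L : V ↪ ℕ, (Finset.univ.sup fun v => (WReach G L r v).ncard) = wcol G r := by
  have : Nonempty (V ↪ ℕ) := ⟨(Fintype.equivFin V).toEmbedding.trans Fin.valEmbedding⟩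
  exact Nat.sInf_mem (Set.range_nonempty _)

/-- The minimum in the definition of `col` is attained. -/
theorem exists_col_eq [Fintype V] (G : SimpleGraph V) (r : ℕ) :
    ∃ L : V ↪ ℕ, (Finset.univ.sup fun v => (SReach G L r v).ncard) = col G r := by
  have : Nonempty (V ↪ ℕ) := ⟨(Fintype.equivFin V).toEmbedding.trans Fin.valEmbedding⟩
  exact Nat.sInf_mem (Set.range_nonempty _)

end GeneralisedColouring

namespace GeneralisedColouring

/-! Gluing interval patterns mirrors Pascal's rule, giving a pattern with at most `k` earlier
neighbours per level whose last level descends to `(s + k).choose k` levels in `s` steps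
(`exists_pattern`). Unfold it over an `M`-ary tree of words. Ordering words by length, a strong path
from `v` stays among extensions of `v` until it ends at `v` or a lower neighbour, so `col ≤ k + 1`;
a clique gives equality. In any order with small weak reaches, large `M` yields a branch on which
adjacent vertices increase with length (`exists_ordered_branch`). Descents from its end are then
weak paths, so `wcol` is at least the binomial coefficient. -/

/-! ### Interval patterns

A function `d : ℕ → ℕ` describes an interval graph on the levels `0, 1, …, n`, in which the level
`j` is joined to the later levels `i ≤ d j`. -/

/-- `DescendsTo d s i j`: the level `j` can be reached from `i` by at most `s` steps, each leading
to an earlier adjacent level. -/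
def DescendsTo (d : ℕ → ℕ) : ℕ → ℕ → ℕ → Prop
  | 0, i, j => i = j
  | s + 1, i, j => i = j ∨ ∃ m, m < i ∧ i ≤ d m ∧ DescendsTo d s m j

/-- The levels before `i` that are adjacent to `i`. -/
def aliveAt (d : ℕ → ℕ) (i : ℕ) : Finset ℕ := {j ∈ Finset.range i | i ≤ d j}

theorem mem_aliveAt {d : ℕ → ℕ} {i j : ℕ} : j ∈ aliveAt d i ↔ j < i ∧ i ≤ d j := by
  simp [aliveAt]

theorem DescendsTo.refl (d : ℕ → ℕ) (s i : ℕ) : DescendsTo d s i i := by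
  cases s with
  | zero => rfl
  | succ s => exact Or.inl rfl

theorem DescendsTo.le {d : ℕ → ℕ} {s i j : ℕ} (h : DescendsTo d s i j) : j ≤ i := by
  induction s generalizing i with
  | zero => exact h.symm.le
  | succ s ih =>
    rcases h with rfl | ⟨m, hm, -, h⟩
    · exact le_rfl
    · exact (ih h).trans hm.le

theorem DescendsTo.congr_shift {d d' : ℕ → ℕ} {c n s i j : ℕ} (hi : i ≤ n)
    (hd : ∀ a b, a < b → b ≤ n → b ≤ d a → b + c ≤ d' (a + c)) (h : DescendsTo d s i j) :
    DescendsTo d' s (i + c) (j + c) := by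
  induction s generalizing i with
  | zero => exact congrArg (· + c) h
  | succ s ih =>
    rcases h with rfl | ⟨m, hm, hmi, h⟩
    · exact Or.inl rfl
    · exact Or.inr ⟨m + c, by omega, hd m i hm hi hmi, ih (by omega) h⟩

/-- The pattern consisting of the pattern `d₁` up to level `n₁`, followed by the pattern `d₂` up to
level `n₂`, whose levels are all joined to the level `n₁`. -/
def appendPattern (n₁ n₂ : ℕ) (d₁ d₂ : ℕ → ℕ) (j : ℕ) : ℕ :=
  if j < n₁ then min (d₁ j) n₁ else if j = n₁ then n₂ + (n₁ + 1)
    else d₂ (j - (n₁ + 1)) + (n₁ + 1)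

theorem card_aliveAt_appendPattern_le {n₁ n₂ k : ℕ} {d₁ d₂ : ℕ → ℕ}
    (h₁ : ∀ i ≤ n₁, (aliveAt d₁ i).card ≤ k + 1) (h₂ : ∀ i ≤ n₂, (aliveAt d₂ i).card ≤ k)
    {i : ℕ} (hi : i ≤ n₂ + (n₁ + 1)) :
    (aliveAt (appendPattern n₁ n₂ d₁ d₂) i).card ≤ k + 1 := by
  by_cases h : i ≤ n₁
  · refine (Finset.card_le_card fun j hj => ?_).trans (h₁ i h)
    rw [mem_aliveAt] at hj ⊢
    have hj' : j < n₁ := by omega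
    simp only [appendPattern, if_pos hj'] at hj
    omega
  · obtain ⟨i, rfl⟩ : ∃ a, i = a + (n₁ + 1) := ⟨i - (n₁ + 1), by omega⟩
    have hsub : aliveAt (appendPattern n₁ n₂ d₁ d₂) (i + (n₁ + 1)) ⊆
        insert n₁ ((aliveAt d₂ i).image (· + (n₁ + 1))) := by
      intro j hj
      rw [mem_aliveAt, appendPattern] at hj
      split_ifs at hj with h1 h2
      -- The `min` in `appendPattern` keeps levels below `n₁` from reaching the second block.
      · omega
      · simp [h2]
      · refine Finset.mem_insert_of_mem (Finset.mem_image.2 ⟨j - (n₁ + 1), ?_, by omega⟩)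
        rw [mem_aliveAt]
        omega
    refine (Finset.card_le_card hsub).trans ((Finset.card_insert_le _ _).trans ?_)
    exact Nat.succ_le_succ (Finset.card_image_le.trans (h₂ i (by omega)))

/-- There is a pattern in which every level has at most `k` earlier neighbours, and in which the
last level descends to at least `(s + k).choose k` levels in at most `s` steps. -/
theorem exists_pattern (k r : ℕ) : ∃ (n : ℕ) (d : ℕ → ℕ),
    (∀ i ≤ n, (aliveAt d i).card ≤ k) ∧
    ∀ s ≤ r, ∃ S : Finset ℕ, (s + k).choose k ≤ S.card ∧ ∀ j ∈ S, DescendsTo d s n j := by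
  induction k generalizing r with
  | zero =>
    refine ⟨0, fun _ => 0, fun i hi => ?_, fun s _ => ⟨{0}, by simp, fun j hj => ?_⟩⟩
    · simp [aliveAt, Nat.le_zero.1 hi]
    · rw [Finset.mem_singleton.1 hj]
      exact .refl ..
  | succ k ihk =>
    induction r with
    | zero =>
      refine ⟨0, fun _ => 0, fun i hi => ?_, fun s hs => ⟨{0}, ?_, fun j hj => ?_⟩⟩
      · simp [aliveAt, Nat.le_zero.1 hi]
      · simp [Nat.le_zero.1 hs]
      · rw [Finset.mem_singleton.1 hj]
        exact .refl ..
    | succ r ihr =>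
      obtain ⟨n₁, d₁, hc₁, hr₁⟩ := ihr
      obtain ⟨n₂, d₂, hc₂, hr₂⟩ := ihk (r + 1)
      -- From the last level, either spend one step on the hub `n₁` and `s` steps in the first
      -- block, or all `s + 1` steps in the second block.
      refine ⟨n₂ + (n₁ + 1), appendPattern n₁ n₂ d₁ d₂,
        fun i hi => card_aliveAt_appendPattern_le hc₁ hc₂ hi, fun s hs => ?_⟩
      cases s with
      | zero => exact ⟨{n₂ + (n₁ + 1)}, by simp, fun j hj => (Finset.mem_singleton.1 hj).symm⟩
      | succ s =>
        obtain ⟨S₁, hS₁, hd₁⟩ := hr₁ s (by omega)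
        obtain ⟨S₂, hS₂, hd₂⟩ := hr₂ (s + 1) hs
        refine ⟨S₁ ∪ S₂.image (· + (n₁ + 1)), ?_, fun j hj => ?_⟩
        · rw [Finset.card_union_of_disjoint, Finset.card_image_of_injective _
            (add_left_injective _)]
          · have : (s + 1 + (k + 1)).choose (k + 1) =
                (s + 1 + k).choose k + (s + (k + 1)).choose (k + 1) := by
              rw [show s + 1 + (k + 1) = (s + 1 + k) + 1 by ring, Nat.choose_succ_succ,
                show s + (k + 1) = s + 1 + k by ring]
            omega
          · rw [Finset.disjoint_left]
            intro j hj hj'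
            obtain ⟨a, -, rfl⟩ := Finset.mem_image.1 hj'
            have := (hd₁ _ hj).le
            omega
        · rcases Finset.mem_union.1 hj with hj | hj
          · refine Or.inr ⟨n₁, by omega, by simp [appendPattern], ?_⟩
            refine (hd₁ j hj).congr_shift (c := 0) le_rfl fun a b hab hb hba => ?_
            have : a < n₁ := by omega
            simp only [add_zero, appendPattern, if_pos this]
            omega
          · obtain ⟨a, ha, rfl⟩ := Finset.mem_image.1 hj
            refine (hd₂ a ha).congr_shift le_rfl fun a b hab hb hba => ?_
            rw [appendPattern, if_neg (by omega), if_neg (by omega)]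
            simpa using hba

/-! ### Branching a pattern -/

/-- The vertices of the branched pattern: the words of length at most `n` in `M` letters. -/
abbrev Word (M n : ℕ) : Type := {l : List (Fin M) // l.length ≤ n}

noncomputable instance (M n : ℕ) : Fintype (Word M n) :=
  (List.finite_length_le (Fin M) n).fintype

/-- The word `a` is a prefix of `b`, and its length is an earlier neighbour of the length of `b` in
the pattern `d`. -/
def IsLower (d : ℕ → ℕ) {M n : ℕ} (a b : Word M n) : Prop :=
  a.1 <+: b.1 ∧ a.1.length < b.1.length ∧ b.1.length ≤ d a.1.length

/-- The graph on words in which each word is joined to its prefixes as prescribed by `d`. -/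
def wordGraph (d : ℕ → ℕ) (M n : ℕ) : SimpleGraph (Word M n) where
  Adj a b := IsLower d a b ∨ IsLower d b a
  symm := ⟨fun _ _ h => h.symm⟩
  loopless := ⟨fun _ h => h.elim (fun h => h.2.1.ne rfl) fun h => h.2.1.ne rfl⟩

variable {d : ℕ → ℕ} {M n : ℕ}

theorem ncard_isLower_le (b : Word M n) :
    {a | IsLower d a b}.ncard ≤ (aliveAt d b.1.length).card := by
  rw [← Set.ncard_coe_finset]
  refine Set.ncard_le_ncard_of_injOn (fun a => a.1.length)
    (fun a ha => mem_aliveAt.2 ⟨ha.2.1, ha.2.2⟩) (fun a ha b hb hab => ?_) (Finset.finite_toSet _)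
  exact Subtype.ext ((List.prefix_of_prefix_length_le ha.1 hb.1 hab.le).eq_of_length hab)

/-- A linear order of the words that refines the order by length. -/
theorem exists_embedding_length_lt (M n : ℕ) :
    ∃ L : Word M n ↪ ℕ, ∀ a b : Word M n, a.1.length < b.1.length → L a < L b := by
  let e := Fintype.equivFin (Word M n)
  have key : ∀ a b : Word M n, a.1.length < b.1.length →
      a.1.length * Fintype.card (Word M n) + e a < b.1.length * Fintype.card (Word M n) + e b := by
    intro a b h
    have h1 := (e a).2
    have h2 := Nat.mul_le_mul_right (Fintype.card (Word M n)) (Nat.succ_le_of_lt h)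
    rw [Nat.succ_mul] at h2
    omega
  refine ⟨⟨fun a => a.1.length * Fintype.card (Word M n) + e a, fun a b hab => ?_⟩, key⟩
  rcases lt_trichotomy a.1.length b.1.length with h | h | h
  · exact absurd hab (key a b h).ne
  · simp only [h, add_right_inj] at hab
    exact e.injective (Fin.ext hab)
  · exact absurd hab (key b a h).ne'

/-- An edge from an extension `w` of `v` to a prefix `u` of `v` has `v.length ≤ w.length ≤ d
u.length`, so `u` is `v` or a lower neighbour of `v`. Starting at any extension of `v` makes the
induction work. -/
theorem eq_or_isLower_of_walk {L : Word M n ↪ ℕ}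
    (hL : ∀ a b : Word M n, a.1.length < b.1.length → L a < L b) {v w u : Word M n}
    (p : (wordGraph d M n).Walk w u) (hv : v.1 <+: w.1) (hu : L u ≤ L v)
    (hp : ∀ x ∈ p.support, x = v ∨ x = u ∨ L v < L x) : u = v ∨ IsLower d u v := by
  have hlen : ∀ {a b : Word M n}, L a ≤ L b → a.1.length ≤ b.1.length := fun h =>
    not_lt.1 fun h' => (hL _ _ h').not_ge h
  induction p with
  | nil => exact Or.inl (Subtype.ext (hv.eq_of_length_le (hlen hu)).symm)
  | @cons w x u h p ih =>
    have hx : x = v ∨ x = u ∨ L v < L x := hp x (by simp)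
    rcases hx with rfl | rfl | hx
    · exact ih List.prefix_rfl hu fun y hy => hp y (by simp [hy])
    · rcases h with h | h
      · exact Or.inl (Subtype.ext ((hv.trans h.1).eq_of_length_le (hlen hu)).symm)
      · have hxv := List.prefix_of_prefix_length_le h.1 hv (hlen hu)
        rcases hxv.length_le.eq_or_lt with h' | h'
        · exact Or.inl (Subtype.ext (hxv.eq_of_length h'))
        · exact Or.inr ⟨hxv, h', hv.length_le.trans h.2.2⟩
    · refine ih ?_ hu fun y hy => hp y (by simp [hy])
      rcases h with h | h
      · exact hv.trans h.1
      · exact List.prefix_of_prefix_length_le hv h.1 (hlen hx.le)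

theorem col_wordGraph_le {k : ℕ} (hd : ∀ i ≤ n, (aliveAt d i).card ≤ k) (r : ℕ) :
    col (wordGraph d M n) r ≤ k + 1 := by
  obtain ⟨L, hL⟩ := exists_embedding_length_lt M n
  refine (Nat.sInf_le (Set.mem_range_self L)).trans (Finset.sup_le fun v _ => ?_)
  have hsub : SReach (wordGraph d M n) L r v ⊆ insert v {u | IsLower d u v} := by
    rintro u ⟨p, -, -, hmin, hin⟩
    refine eq_or_isLower_of_walk hL p List.prefix_rfl (hmin v p.start_mem_support) fun x hx => ?_
    by_cases h1 : x = v
    · exact Or.inl h1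
    by_cases h2 : x = u
    · exact Or.inr (Or.inl h2)
    exact Or.inr (Or.inr (hin x hx h1 h2))
  refine (Set.ncard_le_ncard hsub (Set.toFinite _)).trans ((Set.ncard_insert_le _ _).trans ?_)
  exact Nat.succ_le_succ ((ncard_isLower_le v).trans (hd _ v.2))

/-! ### General bounds -/

theorem mem_WReach_of_walk {V : Type*} {G : SimpleGraph V} {L : V → ℕ} {r : ℕ} {v u : V}
    (p : G.Walk v u) (hlen : p.length ≤ r) (hmin : ∀ w ∈ p.support, L u ≤ L w) :
    u ∈ WReach G L r v := by
  classical
  exact ⟨p.bypass, p.bypass_isPath, p.length_bypass_le_length.trans hlen,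
    fun w hw => hmin w (p.support_bypass_subset_support hw)⟩

theorem mem_SReach_of_adj {V : Type*} {G : SimpleGraph V} {L : V → ℕ} {r : ℕ} {v u : V}
    (hr : 1 ≤ r) (h : G.Adj v u) (hL : L u ≤ L v) : u ∈ SReach G L r v := by
  refine ⟨h.toWalk, .of_adj h, by simpa using hr, ?_, ?_⟩
  · simp [hL]
  · simp +contextual

theorem self_mem_SReach {V : Type*} (G : SimpleGraph V) (L : V → ℕ) (r : ℕ) (v : V) :
    v ∈ SReach G L r v :=
  ⟨.nil, .nil, by simp, by simp, by simp⟩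

/-- The size of a clique is a lower bound for `col`. -/
theorem card_le_col_of_isClique {V : Type*} [Fintype V] {G : SimpleGraph V} {s : Finset V}
    (hs : G.IsClique s) {r : ℕ} (hr : 1 ≤ r) : s.card ≤ col G r := by
  rcases s.eq_empty_or_nonempty with rfl | hne
  · simp
  obtain ⟨L, hL⟩ := exists_col_eq G r
  obtain ⟨v, hv, hmax⟩ := s.exists_max_image L hne
  rw [← hL, ← Set.ncard_coe_finset]
  refine le_trans (Set.ncard_le_ncard (fun u hu => ?_) (Set.toFinite _))
    (Finset.le_sup (f := fun v => (SReach G L r v).ncard) (Finset.mem_univ v))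
  by_cases huv : u = v
  · rw [huv]
    exact self_mem_SReach ..
  · exact mem_SReach_of_adj hr (hs hv hu (Ne.symm huv)) (hmax u hu)

/-! ### Lower bounds for branched patterns -/

/-- The prefix of length `min i n` of a word. -/
def Word.take (s : Word M n) (i : ℕ) : Word M n := ⟨s.1.take i, (s.1.length_take_le' i).trans s.2⟩

theorem Word.length_take {s : Word M n} {i : ℕ} (h : i ≤ s.1.length) :
    (s.take i).1.length = i := by
  simp [Word.take, h]

theorem isLower_take {s : Word M n} {i j : ℕ} (hi : i ≤ s.1.length) (hji : j < i) (hd : i ≤ d j) :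
    IsLower d (s.take j) (s.take i) := by
  refine ⟨List.take_prefix_take_left hji.le, ?_⟩
  rw [Word.length_take hi, Word.length_take (hji.le.trans hi)]
  exact ⟨hji, hd⟩

/-- Level `i` and its earlier neighbours form a clique: if `a < b < i ≤ d a`, then `b ≤ d a`. -/
theorem add_one_le_col_wordGraph {k r i : ℕ} (hr : 1 ≤ r) (hM : 0 < M) (hi : i ≤ n)
    (hk : k ≤ (aliveAt d i).card) : k + 1 ≤ col (wordGraph d M n) r := by
  classical
  let s : Word M n := ⟨List.replicate n ⟨0, hM⟩, by simp⟩
  have hs : s.1.length = n := by simp [s]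
  have hinj : Set.InjOn s.take (insert i (aliveAt d i) : Finset ℕ) := by
    intro a ha b hb hab
    have hle : ∀ a ∈ insert i (aliveAt d i), a ≤ s.1.length := by
      intro a ha
      rcases Finset.mem_insert.1 ha with rfl | ha
      · omega
      · have := (mem_aliveAt.1 ha).1
        omega
    rw [← Word.length_take (hle a ha), hab, Word.length_take (hle b hb)]
  have hcard : ((insert i (aliveAt d i)).image s.take).card = (aliveAt d i).card + 1 := by
    rw [Finset.card_image_of_injOn hinj, Finset.card_insert_of_notMem]
    simp [mem_aliveAt]
  refine le_trans (by rw [hcard]; omega)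
    (card_le_col_of_isClique (s := (insert i (aliveAt d i)).image s.take) ?_ hr)
  have key : ∀ a ∈ insert i (aliveAt d i), ∀ b ∈ insert i (aliveAt d i), a < b →
      IsLower d (s.take a) (s.take b) := by
    intro a ha b hb hab
    simp only [Finset.mem_insert, mem_aliveAt] at ha hb
    exact isLower_take (by omega) hab (by omega)
  intro x hx y hy hxy
  obtain ⟨a, ha, rfl⟩ := Finset.mem_image.1 (Finset.mem_coe.1 hx)
  obtain ⟨b, hb, rfl⟩ := Finset.mem_image.1 (Finset.mem_coe.1 hy)
  rcases lt_trichotomy a b with h | rfl | h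
  · exact Or.inl (key a ha b hb h)
  · exact absurd rfl hxy
  · exact Or.inr (key b hb a ha h)

/-- If all weak reaches are smaller than `B` and there is sufficient branching, then some branch of
length `n` is ordered by length, as far as adjacent vertices are concerned. -/
theorem exists_ordered_branch {B r : ℕ} (hr : 1 ≤ r) (hM : n * B < M) (L : Word M n → ℕ)
    (hB : ∀ v, (WReach (wordGraph d M n) L r v).ncard ≤ B) :
    ∃ s : Word M n, s.1.length = n ∧
      ∀ i j, i ≤ n → j < i → i ≤ d j → L (s.take j) < L (s.take i) := by
  suffices h : ∀ m ≤ n, ∃ s : Word M n, s.1.length = m ∧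
      ∀ i j, i ≤ m → j < i → i ≤ d j → L (s.take j) < L (s.take i) from h n le_rfl
  intro m hm
  induction m with
  | zero => exact ⟨⟨[], by simp⟩, rfl, fun i j hi hj => by omega⟩
  | succ m ih =>
    obtain ⟨s, hs, hord⟩ := ih (by omega)
    let ext : Fin M → Word M n := fun c => ⟨s.1 ++ [c], by simp; omega⟩
    have htake : ∀ c i, i ≤ m → (ext c).take i = s.take i := fun c i hi =>
      Subtype.ext (List.take_append_of_le_length (by omega))
    have hfull : ∀ c, (ext c).take (m + 1) = ext c := fun c =>
      Subtype.ext (List.take_of_length_le (by simp [ext, hs]))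
    have hext : Function.Injective ext := fun a b hab => by simpa [ext] using hab
    -- Pigeonhole: the `m + 1 ≤ n` prefixes of `s` weakly reach at most `n * B < M` words in total,
    -- so some child is missed.
    obtain ⟨c, hc⟩ : ∃ c, ∀ j ≤ m, ext c ∉ WReach (wordGraph d M n) L r (s.take j) := by
      by_contra! hcon
      have hsub : Set.range ext ⊆
          ⋃ j ∈ Finset.range (m + 1), WReach (wordGraph d M n) L r (s.take j) := by
        rintro _ ⟨c, rfl⟩
        obtain ⟨j, hj, hmem⟩ := hcon c
        exact Set.mem_biUnion (Finset.mem_coe.2 (Finset.mem_range.2 (by omega))) hmem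
      have h1 : M ≤ (Set.range ext).ncard := by
        rw [← Set.image_univ, Set.ncard_image_of_injective _ hext]
        simp
      have h2 := Set.ncard_le_ncard hsub (Set.toFinite _)
      have h3 := Finset.set_ncard_biUnion_le (Finset.range (m + 1))
        fun j => WReach (wordGraph d M n) L r (s.take j)
      have h4 := Finset.sum_le_card_nsmul (Finset.range (m + 1)) _ B fun j _ => hB (s.take j)
      have h5 := Nat.mul_le_mul_right B hm
      simp only [Finset.card_range, smul_eq_mul] at h4
      omega
    refine ⟨ext c, by simp [ext, hs], fun i j hi hj hd => ?_⟩
    have hlow := isLower_take (s := ext c) (d := d) (i := i) (by simp [ext, hs, hi]) hj hd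
    rcases hi.eq_or_lt with rfl | hi
    · rw [htake c j (by omega), hfull] at hlow ⊢
      -- Otherwise the single edge would make the child weakly reachable.
      refine lt_of_not_ge fun hle => hc j (by omega) ?_
      have hadj : (wordGraph d M n).Adj (s.take j) (ext c) := Or.inl hlow
      exact mem_WReach_of_walk hadj.toWalk (by simpa using hr) (by simp [hle])
    · rw [htake c j (by omega), htake c i (by omega)]
      exact hord i j (by omega) hj hd

theorem exists_walk_of_descendsTo {L : Word M n → ℕ} {s : Word M n} (hs : s.1.length = n)
    (hord : ∀ i j, i ≤ n → j < i → i ≤ d j → L (s.take j) < L (s.take i)) {r i j : ℕ}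
    (hi : i ≤ n) (h : DescendsTo d r i j) :
    ∃ p : (wordGraph d M n).Walk (s.take i) (s.take j),
      p.length ≤ r ∧ ∀ w ∈ p.support, L (s.take j) ≤ L w := by
  induction r generalizing i with
  | zero =>
    obtain rfl : i = j := h
    exact ⟨.nil, by simp, by simp⟩
  | succ r ih =>
    rcases h with rfl | ⟨m, hm, hmi, h⟩
    · exact ⟨.nil, by simp, by simp⟩
    · obtain ⟨p, hp, hmin⟩ := ih (by omega) h
      have hadj : (wordGraph d M n).Adj (s.take i) (s.take m) :=
        Or.inr (isLower_take (by omega) hm hmi)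
      refine ⟨.cons hadj p, by simpa using hp, fun w hw => ?_⟩
      rcases List.mem_cons.1 (by simpa using hw) with rfl | hw
      · exact (hmin _ p.start_mem_support).trans (hord i m hi hm hmi).le
      · exact hmin w hw

theorem card_le_wcol_wordGraph {r : ℕ} (hr : 1 ≤ r) {S : Finset ℕ} (hM : n * S.card < M)
    (hS : ∀ j ∈ S, DescendsTo d r n j) : S.card ≤ wcol (wordGraph d M n) r := by
  obtain ⟨L, hL⟩ := exists_wcol_eq (wordGraph d M n) r
  have hle : ∀ v, (WReach (wordGraph d M n) L r v).ncard ≤ wcol (wordGraph d M n) r := fun v =>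
    hL ▸ Finset.le_sup (f := fun v => (WReach (wordGraph d M n) L r v).ncard) (Finset.mem_univ v)
  by_contra! hlt
  obtain ⟨s, hs, hord⟩ := exists_ordered_branch hr hM L
    fun v => (hle v).trans hlt.le
  refine hlt.not_ge (le_trans ?_ (hle (s.take n)))
  rw [← Set.ncard_coe_finset]
  refine Set.ncard_le_ncard_of_injOn s.take (fun j hj => ?_) (fun a ha b hb hab => ?_)
    (Set.toFinite _)
  · obtain ⟨p, hp, hmin⟩ := exists_walk_of_descendsTo hs hord le_rfl (hS j hj)
    exact mem_WReach_of_walk p hp hmin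
  · rw [← Word.length_take (s := s) ((hS a ha).le.trans hs.ge), hab,
      Word.length_take ((hS b hb).le.trans hs.ge)]

/-- The product `(r + k) ⋯ (k + 1)` has `r` factors, each at least `k + 1`, and `r ! ≤ r ^ r`. -/
theorem div_pow_le_choose (k : ℕ) {r : ℕ} (hr : 1 ≤ r) :
    (((k + 1 : ℕ) : ℝ) / r) ^ r ≤ ((r + k).choose k : ℝ) := by
  have h1 : (k + 1) ^ r ≤ (r + k).choose k * r ^ r := by
    have h2 := Nat.pow_sub_le_descFactorial (r + k) r
    rw [Nat.descFactorial_eq_factorial_mul_choose, show r + k + 1 - r = k + 1 by omega,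
      Nat.choose_symm_add] at h2
    rw [mul_comm]
    exact h2.trans (Nat.mul_le_mul_right _ (Nat.factorial_le_pow r))
  rw [div_pow, div_le_iff₀ (by positivity)]
  exact_mod_cast h1

end GeneralisedColouring

theorem mainTheorem5 (k r : ℕ) (hk : 1 ≤ k) (hr : 1 ≤ r) :
    ∃ (V : Type) (_ : Fintype V) (G : SimpleGraph V), ∀ r' : ℕ, 1 ≤ r' → r' ≤ r →
      GeneralisedColouring.col G r' = k + 1 ∧
      ((GeneralisedColouring.col G r' : ℝ) / (r' : ℝ)) ^ r' ≤
        (GeneralisedColouring.wcol G r' : ℝ) := by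
  classical
  open GeneralisedColouring in
  obtain ⟨n, d, hd, hS⟩ := exists_pattern k r
  -- With `s = 1`, level `n` descends to `k + 1` levels: itself and earlier neighbours.
  have halive : k ≤ (aliveAt d n).card := by
    obtain ⟨S, hcard, hdesc⟩ := hS 1 hr
    have hsub : S ⊆ insert n (aliveAt d n) := by
      intro j hj
      rcases hdesc j hj with rfl | ⟨m, hm, hmn, h⟩
      · exact Finset.mem_insert_self ..
      · obtain rfl : m = j := h
        exact Finset.mem_insert_of_mem (mem_aliveAt.2 ⟨hm, hmn⟩)
    have h1 := (Finset.card_le_card hsub).trans (Finset.card_insert_le _ _)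
    rw [add_comm 1 k, Nat.choose_succ_self_right] at hcard
    omega
  -- Each set `S` lies in `{0, …, n}`, so this branching suffices for every `r'` at once.
  refine ⟨Word (n * (n + 1) + 1) n, inferInstance, wordGraph d (n * (n + 1) + 1) n,
    fun r' h1 hr' => ?_⟩
  have hcol : col (wordGraph d (n * (n + 1) + 1) n) r' = k + 1 :=
    (col_wordGraph_le hd r').antisymm (add_one_le_col_wordGraph h1 (by omega) le_rfl halive)
  refine ⟨hcol, ?_⟩
  obtain ⟨S, hcard, hdesc⟩ := hS r' hr'
  have hSn : S.card ≤ n + 1 := by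
    rw [← Finset.card_range (n + 1)]
    exact Finset.card_le_card fun j hj => Finset.mem_range_succ_iff.2 (hdesc j hj).le
  have hw : S.card ≤ wcol (wordGraph d (n * (n + 1) + 1) n) r' :=
    card_le_wcol_wordGraph h1 (Nat.lt_succ_of_le (Nat.mul_le_mul_left n hSn)) hdesc
  rw [hcol]
  exact (div_pow_le_choose k h1).trans (by exact_mod_cast hcard.trans hw)
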